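/- Work in the complex analytic category. Let $\mathbb P^{1|1}$ be the complex supermanifold with two charts $(z|\theta)$ and $(w|\eta)$ glued by $z=1/w$, $\theta=\eta/w$, and structure sheaf $\mathcal O$. All sheaves below are locally free sheaves of $\mathbb Z_2$-graded $\mathcal O$-modules, given by a homogeneous frame in each chart; parity change is $\Pi\mathcal E=\mathcal E\otimes\Pi\mathcal O$ (frame $\pi e_i$, same transition matrix, opposite parity), and tensor products carry the Koszul sign. The frames are: $\partial_z,\partial_\theta$ of the tangent sheaf $\mathcal T$; $dz,d\theta$ of $\Pi\mathcal T^*$ ($d\theta$ even, $dz$ odd), so that $d\theta=\frac{d\eta}{w}-\frac{\eta}{w^2}dw$ and $dz=-\frac{dw}{w^2}$; the even frame $\mathcal D=\mathcal D[dz|d\theta]$ of $\mathcal Ber=\mathcal Ber(\Pi\mathcal T^*)^*$; and $(\pi\partial_\theta)^n\,|\,\pi\partial_z(\pi\partial_\theta)^{n-1}$ of the supersymmetric power $Sym^n\Pi\mathcal T$ (only $1$ for $n=0$). For $k\ge 0$ let $\Omega^{-k;0}$ be the degree $-k$ part of the localization of $Sym^\bullet\Pi\mathcal T^*$ at $d\theta$,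 i.e. the sheaf with frame $\frac1{d\theta^k}\,\big|\,\frac{dz}{d\theta^{k+1}}$; these are the inverse superforms for $k>0$, and the extended superforms of degree $0$ for $k=0$. For $n\ge0$ let $\Omega^{1-n;1}=\mathcal Ber\otimes Sym^n\Pi\mathcal T$ be the integral forms of degree $1-n$, with frame written also as $\mathcal D\otimes(\pi\partial_\theta)^n=\delta^{(n)}(d\theta)\,dz$ and, for $n>0$, $\mathcal D\otimes\pi\partial_z(\pi\partial_\theta)^{n-1}=\delta^{(n-1)}(d\theta)$. Then: 1. For every $k>0$ there is a (parity-preserving, $\mathcal O$-linear) isomorphism of sheaves $\varphi_k:\Omega^{-k;0}\cong\Pi\mathcal Ber\otimes Sym^k\Pi\mathcal T$ given in both charts by the constant rescaling $$\frac1{d\theta^k}\mapsto\sqrt k\;\pi\mathcal D\otimes\pi\partial_z(\pi\partial_\theta)^{k-1},\qquad \frac{dz}{d\theta^{k+1}}\mapsto-\frac1{\sqrt k}\;\pi\mathcal D\otimes(\pi\partial_\theta)^k .$$ 2. In degree $0$ there is an isomorphism $\psi:\Omega^{0;0}\cong\mathcal O\oplus\Pi\mathcal Ber$ with $1\mapsto(1,0)$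 and $\frac{dz}{d\theta}\mapsto(0,\pi\mathcal D)$ in both charts. 3. For every $n\ge0$, the parity change $\mathcal D\otimes t\mapsto\pi\mathcal D\otimes t$ on frame elements $t$ of $Sym^n\Pi\mathcal T$ defines an odd morphism of sheaves $\pi:\Omega^{1-n;1}\to\Pi\mathcal Ber\otimes Sym^n\Pi\mathcal T$ (odd morphism means $\pi(fs)=(-1)^{|f|}f\,\pi(s)$, and parity is reversed). Likewise the action of $\Theta(\iota_{\partial_\theta})$ on the local generators, $$\delta^{(n)}(d\theta)\,dz\mapsto(-1)^n n!\,\frac{dz}{d\theta^{n+1}},\qquad \delta^{(n-1)}(d\theta)\mapsto(-1)^{n-1}(n-1)!\,\frac1{d\theta^{n}}\quad(n>0),$$ defines a global odd morphism of sheaves $\Theta:\Omega^{1-n;1}\to\Omega^{-n;0}$. For $n>0$, both $\pi$ and $\Theta$ are bijective on sections over every open set (isomorphisms up to parity), and $\varphi_n\circ\Theta=(-1)^{n-1}(n-1)!\sqrt n\;\pi$. In the critical degree $n=0$, the map $\Theta:\mathcal Ber\to\Omega^{0;0}$ is injective on sections over every open set, and $\psi\circ\Theta$ is $s\mapsto(0,\pi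 s)$. -/

import Mathlib

open scoped LaurentPolynomial

noncomputable section

namespace P11

/-! ## Superfunctions of one even and one odd variable, and the gluing of `ℙ^{1|1}` -/

/-- Values of superfunctions: `a + b θ` with `θ² = 0`.  The even part is `fst`, the odd part `snd`.
With one odd variable, supercommutativity of `ℂ[θ]` is plain commutativity. -/
abbrev D : Type := DualNumber ℂ

/-- `a + b θ` is homogeneous of parity `p`. -/
def IsParity (p : ZMod 2) (a : D) : Prop :=
  (p = 0 → a.snd = 0) ∧ (p = 1 → a.fst = 0)

/-- The grading involution `a + b θ ↦ a - b θ`, that is `a ↦ (-1)^{|a|} a`. -/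
def grade (a : D) : D := TrivSqZeroExt.inl a.fst - TrivSqZeroExt.inr a.snd

/-- The Koszul sign `a ↦ (-1)^{p |a|} a` for moving `a` past an element of parity `p`. -/
def koszul (p : ZMod 2) (a : D) : D := if p = 0 then a else grade a

/-- The two coordinates of `ℂ^{1|1}`: the even `z` and the odd `θ`. -/
inductive Coord
  | z
  | θ
  deriving DecidableEq

instance : Fintype Coord := ⟨{.z, .θ}, by rintro (_ | _) <;> simp⟩

/-- Parity of the coordinates. -/
def Coord.parity : Coord → ZMod 2
  | .z => 0
  | .θ => 1

/-- The coordinate change: the coordinates `(1/z, θ/z)` of one of the two charts as superfunctions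
of the coordinates `(z, θ)` of the other (the formula is the same in both directions). -/
def coordChange : Coord → ℂ → D
  | .z => fun z => TrivSqZeroExt.inl z⁻¹
  | .θ => fun z => TrivSqZeroExt.inr z⁻¹

/-- Substitution of the coordinate change at a point `w` of the new chart: `a + b θ ↦ a + b (η/w)`,
where `η` is the odd coordinate of the new chart. -/
def subst (w : ℂ) (a : D) : D :=
  TrivSqZeroExt.inl a.fst + TrivSqZeroExt.inl a.snd * coordChange .θ w

/-- The (left) partial derivatives of a superfunction `f = f₀(z) + f₁(z) θ`. -/
def partialD : Coord → (ℂ → D) → ℂ → D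
  | .z => fun f z =>
      TrivSqZeroExt.inl (deriv (fun u => (f u).fst) z) +
        TrivSqZeroExt.inr (deriv (fun u => (f u).snd) z)
  | .θ => fun f z => TrivSqZeroExt.inl (f z).snd

/-- The two charts of the Riemann sphere `ℙ¹ = ℂ ∪ {∞}`: `z ↦ z` and `w ↦ 1/w`. -/
def chart (c : Fin 2) (z : ℂ) : OnePoint ℂ :=
  if c = 0 then (z : OnePoint ℂ) else if z = 0 then OnePoint.infty else ((z⁻¹ : ℂ) : OnePoint ℂ)

/-- Open subsets of `ℙ¹`. -/
abbrev Op : Type := TopologicalSpace.Opens (OnePoint ℂ)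

/-- The disjoint union of the two coordinate expressions of an open set `U ⊆ ℙ¹`. -/
structure ChartPt (U : Op) : Type where
  c : Fin 2
  pt : ℂ
  mem : chart c pt ∈ U

/-- A superfunction given in both charts over `U` is holomorphic. -/
def IsHolo {U : Op} (f : ChartPt U → D) : Prop :=
  ∀ c : Fin 2, ∃ F G : ℂ → ℂ,
    DifferentiableOn ℂ F {z | chart c z ∈ U} ∧ DifferentiableOn ℂ G {z | chart c z ∈ U} ∧
      ∀ (z : ℂ) (hz : chart c z ∈ U),
        f ⟨c, z, hz⟩ = TrivSqZeroExt.inl (F z) + TrivSqZeroExt.inr (G z)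

theorem IsHolo.add {U : Op} {f g : ChartPt U → D} (hf : IsHolo f) (hg : IsHolo g) :
    IsHolo (f + g) := by
  intro c
  obtain ⟨F, G, hF, hG, h⟩ := hf c
  obtain ⟨F', G', hF', hG', h'⟩ := hg c
  refine ⟨F + F', G + G', hF.add hF', hG.add hG', fun z hz => ?_⟩
  rw [Pi.add_apply, h z hz, h' z hz]
  ext <;> simp

theorem IsHolo.mul {U : Op} {f g : ChartPt U → D} (hf : IsHolo f) (hg : IsHolo g) :
    IsHolo (f * g) := by
  intro c
  obtain ⟨F, G, hF, hG, h⟩ := hf c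
  obtain ⟨F', G', hF', hG', h'⟩ := hg c
  refine ⟨F * F', F * G' + F' * G, hF.mul hF', (hF.mul hG').add (hF'.mul hG), fun z hz => ?_⟩
  rw [Pi.mul_apply, h z hz, h' z hz]
  ext <;> simp [mul_comm]

theorem IsHolo.const {U : Op} (r : ℂ) : IsHolo (fun _ : ChartPt U => (algebraMap ℂ D r)) := by
  intro c
  refine ⟨fun _ => r, fun _ => 0, differentiableOn_const _, differentiableOn_const _, fun z hz => ?_⟩
  ext <;> simp [TrivSqZeroExt.algebraMap_eq_inl]

theorem subst_add (w : ℂ) (a b : D) : subst w (a + b) = subst w a + subst w b := by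
  simp [subst]; ring

theorem subst_mul (w : ℂ) (a b : D) : subst w (a * b) = subst w a * subst w b := by
  ext <;> simp [subst, coordChange]; ring

/-- The structure sheaf `𝒪` of `ℙ^{1|1}`: its sections over `U` are the pairs of holomorphic
superfunctions on the two coordinate expressions of `U` that correspond to each other under
`z = 1/w`, `θ = η/w`. -/
def O (U : Op) : Subalgebra ℂ (ChartPt U → D) where
  carrier := {f | IsHolo f ∧ ∀ (w : ℂ), w ≠ 0 → ∀ (h₁ : chart 1 w ∈ U) (h₀ : chart 0 w⁻¹ ∈ U),
    f ⟨1, w, h₁⟩ = subst w (f ⟨0, w⁻¹, h₀⟩)}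
  mul_mem' := by
    rintro f g ⟨hf, hf'⟩ ⟨hg, hg'⟩
    refine ⟨hf.mul hg, fun w hw h₁ h₀ => ?_⟩
    rw [Pi.mul_apply, Pi.mul_apply, hf' w hw h₁ h₀, hg' w hw h₁ h₀, subst_mul]
  add_mem' := by
    rintro f g ⟨hf, hf'⟩ ⟨hg, hg'⟩
    refine ⟨hf.add hg, fun w hw h₁ h₀ => ?_⟩
    rw [Pi.add_apply, Pi.add_apply, hf' w hw h₁ h₀, hg' w hw h₁ h₀, subst_add]
  algebraMap_mem' := by
    intro r
    refine ⟨IsHolo.const r, fun w hw h₁ h₀ => ?_⟩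
    change algebraMap ℂ D r = subst w (algebraMap ℂ D r)
    ext <;> simp [subst, TrivSqZeroExt.algebraMap_eq_inl]

/-! ## Locally free sheaves given by frames and transition matrices -/

/-- A locally free sheaf on `ℙ^{1|1}` presented by a homogeneous frame `(e_i)` on each of the two
charts and the transition matrix `e_i = ∑ j, g_ij e'_j` on the overlap, where `e` is the frame on the
chart `z`, `e'` the frame on the chart `w = 1/z`, and `g_ij = trans w i j` is a superfunction of the
coordinates `(w, η)`.  Only the values at `w ≠ 0` matter. -/
structure LFSheaf where
  ι : Type
  [fintype : Fintype ι]
  [decEq : DecidableEq ι]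
  /-- parity of the frame elements -/
  parity : ι → ZMod 2
  trans : ℂ → Matrix ι ι D

attribute [instance] LFSheaf.fintype LFSheaf.decEq

/-- Sections over `U`: holomorphic coefficients `s_i` (written on the left of the frame) in both
charts, with `∑ i, s_i e_i = ∑ j, s'_j e'_j` on the overlap. -/
def LFSheaf.sections (E : LFSheaf) (U : Op) : Submodule (O U) (ChartPt U → E.ι → D) where
  carrier := {s | (∀ i, IsHolo fun x => s x i) ∧
    ∀ (w : ℂ), w ≠ 0 → ∀ (h₁ : chart 1 w ∈ U) (h₀ : chart 0 w⁻¹ ∈ U) (j : E.ι),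
      s ⟨1, w, h₁⟩ j = ∑ i, subst w (s ⟨0, w⁻¹, h₀⟩ i) * E.trans w i j}
  add_mem' := by
    rintro s t ⟨hs, hs'⟩ ⟨ht, ht'⟩
    refine ⟨fun i => (hs i).add (ht i), fun w hw h₁ h₀ j => ?_⟩
    simp only [Pi.add_apply, subst_add, add_mul, Finset.sum_add_distrib]
    rw [hs' w hw h₁ h₀, ht' w hw h₁ h₀]
  zero_mem' := by
    refine ⟨fun i => ?_, fun w hw h₁ h₀ j => ?_⟩
    · simpa using IsHolo.const (U := U) 0
    · simp [subst]
  smul_mem' := by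
    rintro ⟨f, hf, hf'⟩ s ⟨hs, hs'⟩
    refine ⟨fun i => hf.mul (hs i), fun w hw h₁ h₀ j => ?_⟩
    change f _ * s _ j = ∑ i, subst w (f _ * s _ i) * E.trans w i j
    rw [hf' w hw h₁ h₀, hs' w hw h₁ h₀, Finset.mul_sum]
    exact Finset.sum_congr rfl fun i _ => by rw [subst_mul, mul_assoc]

instance (E : LFSheaf) (U : Op) : Module (O U) (E.sections U) := (E.sections U).module

instance (E : LFSheaf) (U : Op) : SMul (O U) (E.sections U) := Module.toDistribMulAction.toSMul

/-- Restriction of sections. -/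
def LFSheaf.res (E : LFSheaf) {V U : Op} (h : V ≤ U) (s : E.sections U) : E.sections V :=
  ⟨fun x => s.1 ⟨x.c, x.pt, h x.mem⟩, by
    refine ⟨fun i c => ?_, fun w hw h₁ h₀ j => s.2.2 w hw (h h₁) (h h₀) j⟩
    obtain ⟨F, G, hF, hG, H⟩ := s.2.1 i c
    exact ⟨F, G, hF.mono fun z hz => h hz, hG.mono fun z hz => h hz, fun z hz => H z (h hz)⟩⟩

/-- A section is homogeneous of parity `p`. -/
def LFSheaf.IsHomog (E : LFSheaf) {U : Op} (p : ZMod 2) (s : E.sections U) : Prop :=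
  ∀ x i, IsParity (p + E.parity i) (s.1 x i)

/-- An isomorphism of sheaves of (super) `𝒪`-modules: parity-preserving `𝒪(U)`-linear bijections
on the sections over every open set, compatible with restrictions. -/
structure SheafIso (E F : LFSheaf) where
  app : ∀ U : Op, E.sections U ≃ₗ[O U] F.sections U
  app_res : ∀ {V U : Op} (h : V ≤ U) (s : E.sections U), app V (E.res h s) = F.res h (app U s)
  app_homog : ∀ (U : Op) (p : ZMod 2) (s : E.sections U), E.IsHomog p s → F.IsHomog p (app U s)

/-- An odd morphism of sheaves of `𝒪`-modules: it is additive, reverses parity, satisfies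
`Θ(f s) = (-1)^{|f|} f Θ(s)`, and is compatible with restrictions. -/
structure OddHom (E F : LFSheaf) where
  app : ∀ U : Op, E.sections U →+ F.sections U
  app_res : ∀ {V U : Op} (h : V ≤ U) (s : E.sections U), app V (E.res h s) = F.res h (app U s)
  app_homog : ∀ (U : Op) (p : ZMod 2) (s : E.sections U), E.IsHomog p s → F.IsHomog (p + 1) (app U s)
  app_smul : ∀ (U : Op) (f : O U) (s : E.sections U) (x : ChartPt U) (i : F.ι),
    (app U (f • s)).1 x i = grade (f.1 x) * (app U s).1 x i

/-! ## Operations on locally free sheaves -/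

/-- The structure sheaf, with frame `1`. -/
def structureSheaf : LFSheaf where
  ι := Unit
  parity _ := 0
  trans _ := 1

/-- Parity change `Π E = E ⊗ Π 𝒪`: the frame `π e_i` of opposite parity, with the same transition
matrix (on block matrices `e⁰ | e¹`, once the even elements are listed first, this is the
parity transpose). -/
def LFSheaf.shift (E : LFSheaf) : LFSheaf where
  ι := E.ι
  parity i := E.parity i + 1
  trans := E.trans

/-- Direct sum. -/
def LFSheaf.sum (E F : LFSheaf) : LFSheaf where
  ι := E.ι ⊕ F.ι
  parity := Sum.elim E.parity F.parity
  trans w := Matrix.fromBlocks (E.trans w) 0 0 (F.trans w)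

/-- Tensor product over `𝒪`, with frame `e_i ⊗ f_a`: from `e_i = ∑ g_ij e'_j`, `f_a = ∑ h_ab f'_b`
one gets `e_i ⊗ f_a = ∑ g_ij (-1)^{|e'_j| |h_ab|} h_ab e'_j ⊗ f'_b`. -/
def LFSheaf.tensor (E F : LFSheaf) : LFSheaf where
  ι := E.ι × F.ι
  parity x := E.parity x.1 + F.parity x.2
  trans w x y := E.trans w x.1 y.1 * koszul (E.parity y.1) (F.trans w x.2 y.2)

/-- The supertranspose of a matrix with rows and columns of given parities:
`(A B; C D) ↦ (Aᵗ Cᵗ; -Bᵗ Dᵗ)`. -/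
def superTranspose {ι : Type} (parity : ι → ZMod 2) (g : Matrix ι ι D) : Matrix ι ι D :=
  fun i j => if parity i = 1 ∧ parity j = 0 then -g j i else g j i

/-- The dual sheaf, whose transition matrix is the supertranspose of the inverse. -/
def LFSheaf.dual (E : LFSheaf) : LFSheaf where
  ι := E.ι
  parity := E.parity
  trans w := superTranspose E.parity (E.trans w)⁻¹

/-- The Berezinian sheaf of a sheaf of rank `1|1` with even frame element `e` and odd frame
element `o`: it has rank `1|0`, and its transition function is the Berezinian
`(A - B D⁻¹ C) D⁻¹` of the transition matrix `(A B; C D)`. -/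
def LFSheaf.ber (E : LFSheaf) (e o : E.ι) : LFSheaf where
  ι := Unit
  parity _ := 0
  trans w _ _ := (E.trans w e e - E.trans w e o * (E.trans w o o)⁻¹ * E.trans w o e) *
    (E.trans w o o)⁻¹

/-! ### Symmetric powers and their localization

Let `E` have rank `1|1`, with even frame element `e` and odd frame element `o`.  The symmetric
superalgebra of `E` is locally `𝒪[x] ⊗ Λ[ξ]`, with `x = e` even and `ξ = o` odd.  Its coefficients
`Λ[θ, ξ]` form the algebra with generators `i = θ`, `j = ξ` and relations `i² = j² = 0`, `ij = -ji`. -/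

/-- The exterior algebra on two odd generators `θ = i` and `ξ = j` (with `k = θ ξ`). -/
abbrev Ext2 : Type := QuaternionAlgebra ℂ 0 0 0

/-- Superfunction values `a + b θ` inside `Λ[θ, ξ]`. -/
def emb (a : D) : Ext2 := ⟨a.fst, a.snd, 0, 0⟩

/-- The even frame element of the chart `z`, as an element of `Λ[η, ξ'][x'^{±1}]`. -/
def LFSheaf.evenGen (E : LFSheaf) (e o : E.ι) (w : ℂ) : Ext2[T;T⁻¹] :=
  LaurentPolynomial.C (emb (E.trans w e e)) * LaurentPolynomial.T 1 +
    LaurentPolynomial.C (emb (E.trans w e o) * ⟨0, 0, 1, 0⟩)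

/-- The odd frame element of the chart `z`, as an element of `Λ[η, ξ'][x'^{±1}]`. -/
def LFSheaf.oddGen (E : LFSheaf) (e o : E.ι) (w : ℂ) : Ext2[T;T⁻¹] :=
  LaurentPolynomial.C (emb (E.trans w o e)) * LaurentPolynomial.T 1 +
    LaurentPolynomial.C (emb (E.trans w o o) * ⟨0, 0, 1, 0⟩)

/-- Integral powers, where `q` is invertible if the exponent is negative. -/
def intPow {R : Type} [Ring R] (q : R) : ℤ → R
  | .ofNat n => q ^ n
  | .negSucc n => Ring.inverse q ^ (n + 1)

/-- The monomial `ξ^b x^{m-b}` of the chart `z`, as an element of `Λ[η, ξ'][x'^{±1}]`. -/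
def LFSheaf.monomial (E : LFSheaf) (e o : E.ι) (m : ℤ) (w : ℂ) (b : Fin 2) : Ext2[T;T⁻¹] :=
  E.oddGen e o w ^ (b : ℕ) * intPow (E.evenGen e o w) (m - (b : ℕ))

/-- The coefficient in `𝒪` (written on the left) of the monomial `ξ^b x^{m-b}`. -/
def monomialCoeff (m : ℤ) (q : Ext2[T;T⁻¹]) (b : Fin 2) : D :=
  if b = 0 then TrivSqZeroExt.inl (q.coeff m).re + TrivSqZeroExt.inr (q.coeff m).imI
  else TrivSqZeroExt.inl (q.coeff (m - 1)).imJ + TrivSqZeroExt.inr (q.coeff (m - 1)).imK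

/-- The symmetric power `Sym^k E`, with frame `ξ^b x^{k-b}`, `b ≤ min(1, k)`. -/
def LFSheaf.symPow (E : LFSheaf) (e o : E.ι) (k : ℕ) : LFSheaf where
  ι := {b : Fin 2 // (b : ℕ) ≤ k}
  parity b := ((b.1 : ℕ) : ZMod 2)
  trans w b b' := monomialCoeff k (E.monomial e o k w b.1) b'.1

/-- The part of degree `m ∈ ℤ` of the localization `(Sym E)[e⁻¹]`, with frame
`x^m | ξ x^{m-1}`.  (The even frame elements of the two charts are associates up to nilpotents, so
the localization does not depend on the chart.) -/
def LFSheaf.locSymPow (E : LFSheaf) (e o : E.ι) (m : ℤ) : LFSheaf where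
  ι := Fin 2
  parity b := ((b : ℕ) : ZMod 2)
  trans w b b' := monomialCoeff m (E.monomial e o m w b) b'

/-! ## The sheaves on `ℙ^{1|1}` -/

/-- The tangent sheaf, with frame `∂_z, ∂_θ`: a superderivation `X` is `∑ j, X(y_j) ∂_{y_j}`, so
`∂_{x_i} = ∑ j, (∂y_j/∂x_i) ∂_{y_j}` for the old coordinates `x` and the new coordinates `y`, where
the coefficients are rewritten in the new coordinates. -/
def tangent : LFSheaf where
  ι := Coord
  parity := Coord.parity
  trans w i j := subst w (partialD i (coordChange j) w⁻¹)

/-- The cotangent sheaf, with frame `dz, dθ` and `dx_i = ∑ j, (∂x_i/∂y_j) dy_j`. -/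
def cotangent : LFSheaf where
  ι := Coord
  parity := Coord.parity
  trans w i j := partialD j (coordChange i) w

/-- The Berezinian sheaf `Ber(Π𝒯*)*` of `ℙ^{1|1}`, with frame `𝒟[dz|dθ]`. -/
def berP : LFSheaf := (cotangent.shift.ber .θ .z).dual

/-- `Sym^k Π𝒯`, with frame `(π∂_θ)^k | π∂_z (π∂_θ)^{k-1}` (only `1` if `k = 0`). -/
def symPiT (k : ℕ) : LFSheaf := tangent.shift.symPow .θ .z k

/-- Extended superforms `Ω^{m;0}` of degree `m ∈ ℤ`, where `dθ` is inverted, with frame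
`dθ^m | dz dθ^{m-1}`. -/
def superForms (m : ℤ) : LFSheaf := cotangent.shift.locSymPow .θ .z m

/-- Inverse superforms `Ω^{-k;0}`, with frame `1/dθ^k | dz/dθ^{k+1}` (indices `0 | 1`). -/
def inverseForms (k : ℕ) : LFSheaf := superForms (-(k : ℤ))

/-- Integral forms `Ω^{1-n;1} = Ber ⊗ Sym^n Π𝒯` of degree `1 - n`. -/
def integralForms (n : ℕ) : LFSheaf := berP.tensor (symPiT n)

/-- `Π Ber ⊗ Sym^n Π𝒯`. -/
def piBerSym (n : ℕ) : LFSheaf := berP.shift.tensor (symPiT n)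

/-- The index of the frame element `ℓ ⊗ (π∂_θ)^n` of `L ⊗ Sym^n Π𝒯`. -/
def idxTheta (n : ℕ) : Unit × {b : Fin 2 // (b : ℕ) ≤ n} := ((), ⟨0, Nat.zero_le n⟩)

/-- The index of the frame element `ℓ ⊗ π∂_z (π∂_θ)^{n-1}` of `L ⊗ Sym^n Π𝒯`, `n > 0`. -/
def idxZ (n : ℕ) (hn : 0 < n) : Unit × {b : Fin 2 // (b : ℕ) ≤ n} := ((), ⟨1, hn⟩)

/-- The parity change `s ↦ π s`: the odd map with `𝒟 ⊗ t ↦ π𝒟 ⊗ t` on frames. -/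
def IsParityChange (n : ℕ) (P : OddHom (integralForms n) (piBerSym n)) : Prop :=
  ∀ (U : Op) (s : (integralForms n).sections U) (x : ChartPt U)
    (i : Unit × {b : Fin 2 // (b : ℕ) ≤ n}),
    (P.app U s).1 x i = grade (s.1 x i)

/-- The constant in `Θ(ι_D) δ^{(n)}(dθ) = (-1)^n n! / dθ^{n+1}`, where `D = ∂_θ`. -/
def thetaConst (n : ℕ) : ℂ := (-1) ^ n * (n.factorial : ℂ)

/-- The odd map `Θ(ι_D)`, `D = ∂_θ`, from integral forms to inverse forms.  In terms of the
local generators `𝒟 ⊗ (π∂_θ)^n = δ^{(n)}(dθ) dz` and `𝒟 ⊗ π∂_z (π∂_θ)^{n-1} = δ^{(n-1)}(dθ)` it is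
`δ^{(n)}(dθ) dz ↦ (-1)^n n! dz / dθ^{n+1}` and `δ^{(n-1)}(dθ) ↦ (-1)^{n-1} (n-1)! / dθ^n`. -/
def IsHeaviside (n : ℕ) (Θ : OddHom (integralForms n) (inverseForms n)) : Prop :=
  ∀ (U : Op) (s : (integralForms n).sections U) (x : ChartPt U),
    (Θ.app U s).1 x (1 : Fin 2) = thetaConst n • grade (s.1 x (idxTheta n)) ∧
    (Θ.app U s).1 x (0 : Fin 2) =
      if hn : 0 < n then thetaConst (n - 1) • grade (s.1 x (idxZ n hn)) else 0

end P11

end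

open P11

noncomputable section

namespace P11

/-! Every map in the theorem multiplies frame coefficients by constants, permutes indices and
possibly inserts a Koszul sign. Such a map glues exactly when the constants intertwine the two
transition matrices on `w ≠ 0`, so everything reduces to comparing explicit 2 × 2 matrices.
Expanding `(dη/w - η dw/w²)^(-k)` to first order in the nilpotent term gives the rows `(w^k, k
w^(k-1) η)` and `(0, -w^(k-1))` for inverse forms. The Berezinian sheaf has transition function
`-1/w`, and `π𝒟 ⊗ Sym^k`, with its two frame elements swapped, has rows `(w^k, -w^(k-1) η)` and `(0,
-w^(k-1))`. The diagonals agree and the odd entries differ by the factor `-k`. Hence for `k > 0` a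
diagonal rescaling works once its two constants have ratio `-k`; `√k` and `-1/√k` are one such pair,
and `thetaConst n = -n * thetaConst (n - 1)` is the same condition for `Θ`. Replacing `π𝒟` by `𝒟`
flips the sign of the odd entry, which is what the grading involution in an odd map compensates. For
`k = 0` the odd entry vanishes and the matrix is `diag(1, -1/w)`, whence the splitting and the
inclusion of `Ber` as its second summand. The matrices are computed in `inverseForms_trans`,
`integralForms_trans` and `piBerSym_trans`; `FrameCompat` turns the `matrixCompat_*` identities into
morphisms of sheaves. -/

/-! ## Powers of the generators of the symmetric superalgebra -/

/-- The `m`-th power of the even generator `a x + b η ξ` of `Λ[η, ξ][x^{±1}]`. -/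
def evenPow (a b : ℂ) (m : ℤ) : Ext2[T;T⁻¹] :=
  AddMonoidAlgebra.single m ⟨a ^ m, 0, 0, 0⟩ +
    AddMonoidAlgebra.single (m - 1) ⟨0, 0, 0, m * a ^ (m - 1) * b⟩

theorem evenPow_zero (a b : ℂ) : evenPow a b 0 = 1 := by
  have h1 : (⟨1, 0, 0, 0⟩ : Ext2) = 1 := rfl
  have h0 : (⟨0, 0, 0, 0⟩ : Ext2) = 0 := rfl
  rw [evenPow, Int.cast_zero, zero_mul, zero_mul, zpow_zero, h0, h1, AddMonoidAlgebra.single_zero,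
    add_zero, AddMonoidAlgebra.one_def]

/-- The product `ηξ` is central of square zero, so only the cross terms survive beside `a^(m+n)`,
and their coefficients `m` and `n` add. This makes the first-order binomial formula valid for
negative exponents too, and supplies the inverses. -/
theorem evenPow_mul {a : ℂ} (ha : a ≠ 0) (b : ℂ) (m n : ℤ) :
    evenPow a b m * evenPow a b n = evenPow a b (m + n) := by
  have h0 : (⟨0, 0, 0, 0⟩ : Ext2) = 0 := rfl
  have hn : m + (n - 1) = m + n - 1 := by ring
  have hm : m - 1 + n = m + n - 1 := by ring
  simp only [evenPow, add_mul, mul_add, AddMonoidAlgebra.single_mul_single,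
    QuaternionAlgebra.mk_mul_mk, hn, hm]
  simp only [mul_zero, zero_mul, add_zero, zero_add, sub_zero, h0, AddMonoidAlgebra.single_zero,
    ← zpow_add₀ ha]
  rw [add_assoc, ← AddMonoidAlgebra.single_add]
  congr 2
  ext <;> simp
  rw [zpow_sub₀ ha, zpow_sub₀ ha, zpow_sub₀ ha, zpow_add₀ ha]
  ring

theorem isUnit_evenPow {a : ℂ} (ha : a ≠ 0) (b : ℂ) (m : ℤ) : IsUnit (evenPow a b m) :=
  ⟨⟨evenPow a b m, evenPow a b (-m), by rw [evenPow_mul ha, add_neg_cancel, evenPow_zero],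
    by rw [evenPow_mul ha, neg_add_cancel, evenPow_zero]⟩, rfl⟩

theorem evenPow_pow {a : ℂ} (ha : a ≠ 0) (b : ℂ) (m : ℤ) (n : ℕ) :
    evenPow a b m ^ n = evenPow a b (n * m) := by
  induction n with
  | zero => simp [evenPow_zero]
  | succ n ih => rw [pow_succ, ih, evenPow_mul ha]; congr 1; push_cast; ring

theorem inverse_evenPow {a : ℂ} (ha : a ≠ 0) (b : ℂ) (m : ℤ) :
    Ring.inverse (evenPow a b m) = evenPow a b (-m) := by
  rw [← mul_one (Ring.inverse _), Ring.inverse_mul_eq_iff_eq_mul _ _ _ (isUnit_evenPow ha b m),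
    evenPow_mul ha, add_neg_cancel, evenPow_zero]

theorem intPow_evenPow {a : ℂ} (ha : a ≠ 0) (b : ℂ) (m : ℤ) :
    intPow (evenPow a b 1) m = evenPow a b m := by
  cases m with
  | ofNat n => simp [intPow, evenPow_pow ha]
  | negSucc n =>
    rw [intPow, inverse_evenPow ha, evenPow_pow ha]
    congr 1
    push_cast
    rw [Int.negSucc_eq]
    ring

theorem monomialCoeff_zero (m : ℤ) (p q : Ext2) :
    monomialCoeff m (AddMonoidAlgebra.single m p + AddMonoidAlgebra.single (m - 1) q) 0 =
      TrivSqZeroExt.inl p.re + TrivSqZeroExt.inr p.imI := by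
  simp [monomialCoeff, -LaurentPolynomial.single_eq_C_mul_T]

theorem monomialCoeff_one (m : ℤ) (p q : Ext2) :
    monomialCoeff m (AddMonoidAlgebra.single m p + AddMonoidAlgebra.single (m - 1) q) 1 =
      TrivSqZeroExt.inl q.imJ + TrivSqZeroExt.inr q.imK := by
  simp [monomialCoeff, -LaurentPolynomial.single_eq_C_mul_T]

/-- The transition matrix of `E` on the frame `e`, `o`, at the point `w`, is
`(a, b η; c η, d)`. -/
structure HasBlocks (E : LFSheaf) (e o : E.ι) (w a b c d : ℂ) : Prop where
  ee : E.trans w e e = TrivSqZeroExt.inl a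
  eo : E.trans w e o = TrivSqZeroExt.inr b
  oe : E.trans w o e = TrivSqZeroExt.inr c
  oo : E.trans w o o = TrivSqZeroExt.inl d

namespace HasBlocks

variable {E : LFSheaf} {e o : E.ι} {w a b c d : ℂ}

theorem evenGen_eq (h : HasBlocks E e o w a b c d) : E.evenGen e o w = evenPow a b 1 := by
  rw [LFSheaf.evenGen, h.ee, h.eo, evenPow, ← LaurentPolynomial.single_eq_C_mul_T]
  simp only [emb, QuaternionAlgebra.mk_mul_mk, ← LaurentPolynomial.single_eq_C]
  simp

theorem oddGen_eq (h : HasBlocks E e o w a b c d) : E.oddGen e o w =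
    AddMonoidAlgebra.single 1 ⟨0, c, 0, 0⟩ + AddMonoidAlgebra.single 0 ⟨0, 0, d, 0⟩ := by
  rw [LFSheaf.oddGen, h.oe, h.oo, ← LaurentPolynomial.single_eq_C_mul_T]
  simp only [emb, QuaternionAlgebra.mk_mul_mk, ← LaurentPolynomial.single_eq_C]
  simp

theorem monomial_zero (h : HasBlocks E e o w a b c d) (ha : a ≠ 0) (m : ℤ) :
    E.monomial e o m w 0 = evenPow a b m := by
  simp [LFSheaf.monomial, h.evenGen_eq, intPow_evenPow ha]

/-- The nilpotent part `b ηξ` of the even generator is killed by both `η` and `ξ`, so it does not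
contribute after multiplication by the odd generator. -/
theorem monomial_one (h : HasBlocks E e o w a b c d) (ha : a ≠ 0) (m : ℤ) :
    E.monomial e o m w 1 = AddMonoidAlgebra.single m ⟨0, c * a ^ (m - 1), 0, 0⟩ +
      AddMonoidAlgebra.single (m - 1) ⟨0, 0, d * a ^ (m - 1), 0⟩ := by
  have h0 : (⟨0, 0, 0, 0⟩ : Ext2) = 0 := rfl
  rw [LFSheaf.monomial, h.evenGen_eq, h.oddGen_eq, Fin.val_one, pow_one, Nat.cast_one,
    intPow_evenPow ha]
  simp [evenPow, add_mul, mul_add, AddMonoidAlgebra.single_mul_single, h0,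
    -LaurentPolynomial.single_eq_C_mul_T]

theorem coeff_zero_zero (h : HasBlocks E e o w a b c d) (ha : a ≠ 0) (m : ℤ) :
    monomialCoeff m (E.monomial e o m w 0) 0 = TrivSqZeroExt.inl (a ^ m) := by
  rw [h.monomial_zero ha]
  simp [evenPow, monomialCoeff_zero, -LaurentPolynomial.single_eq_C_mul_T]

theorem coeff_zero_one (h : HasBlocks E e o w a b c d) (ha : a ≠ 0) (m : ℤ) :
    monomialCoeff m (E.monomial e o m w 0) 1 = TrivSqZeroExt.inr (m * a ^ (m - 1) * b) := by
  rw [h.monomial_zero ha]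
  simp [evenPow, monomialCoeff_one, -LaurentPolynomial.single_eq_C_mul_T]

theorem coeff_one_zero (h : HasBlocks E e o w a b c d) (ha : a ≠ 0) (m : ℤ) :
    monomialCoeff m (E.monomial e o m w 1) 0 = TrivSqZeroExt.inr (c * a ^ (m - 1)) := by
  rw [h.monomial_one ha]
  simp [monomialCoeff_zero, -LaurentPolynomial.single_eq_C_mul_T]

theorem coeff_one_one (h : HasBlocks E e o w a b c d) (ha : a ≠ 0) (m : ℤ) :
    monomialCoeff m (E.monomial e o m w 1) 1 = TrivSqZeroExt.inl (d * a ^ (m - 1)) := by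
  rw [h.monomial_one ha]
  simp [monomialCoeff_one, -LaurentPolynomial.single_eq_C_mul_T]

end HasBlocks

/-! ## The transition matrices of the sheaves on `ℙ^{1|1}` -/

/-- The chain rule for `η = θ/z` gives `∂_θ = w ∂_η` and `∂_z = -w² ∂_w - w η ∂_η`. After the parity
shift the `θ` direction is the even one. -/
theorem hasBlocks_tangent {w : ℂ} (hw : w ≠ 0) :
    HasBlocks tangent.shift .θ .z w w 0 (-w) (-w ^ 2) := by
  constructor <;>
    ext <;> simp [LFSheaf.shift, tangent, partialD, coordChange, subst]
  field_simp

theorem hasBlocks_cotangent (w : ℂ) :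
    HasBlocks cotangent.shift .θ .z w w⁻¹ (-(w ^ 2)⁻¹) 0 (-(w ^ 2)⁻¹) := by
  constructor <;>
    ext <;> simp [LFSheaf.shift, cotangent, partialD, coordChange]

theorem LFSheaf.dual_trans_apply (E : LFSheaf) {w : ℂ} {i j : E.ι} (hi : E.parity i ≠ 1) :
    E.dual.trans w i j = (E.trans w)⁻¹ j i :=
  if_neg fun h => hi h.1

theorem inv_eq_of_mul_eq_one_of_unit {R : Type*} [CommRing R] {M : Matrix Unit Unit R} {b : R}
    (h : M () () * b = 1) : M⁻¹ () () = b := by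
  have : M * Matrix.of (fun _ _ => b) = 1 := by
    ext i j
    simpa [Matrix.mul_apply] using h
  rw [Matrix.inv_eq_right_inv this, Matrix.of_apply]

/-- One odd block of the cotangent matrix is zero, so the Berezinian is the quotient of the diagonal
entries, `w⁻¹ / (-w⁻²)`. -/
theorem ber_cotangent_trans {w : ℂ} (hw : w ≠ 0) :
    (cotangent.shift.ber .θ .z).trans w () () = TrivSqZeroExt.inl (-w) := by
  have h := hasBlocks_cotangent w
  simp only [LFSheaf.ber]
  rw [h.ee, h.eo, h.oe, h.oo]
  ext <;> simp
  field_simp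

theorem berP_trans {w : ℂ} (hw : w ≠ 0) (i j : Unit) :
    berP.trans w i j = TrivSqZeroExt.inl (-w⁻¹) := by
  refine ((cotangent.shift.ber .θ .z).dual_trans_apply (i := ()) (j := ()) zero_ne_one).trans
    (inv_eq_of_mul_eq_one_of_unit ?_)
  rw [ber_cotangent_trans hw]
  ext <;> simp [hw]

/-! ## The grading involution -/

theorem grade_grade (a : D) : grade (grade a) = a := by ext <;> simp [grade]

theorem grade_injective : Function.Injective grade :=
  Function.LeftInverse.injective grade_grade

theorem grade_add (a b : D) : grade (a + b) = grade a + grade b := by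
  ext <;> simp [grade]; ring

theorem grade_mul (a b : D) : grade (a * b) = grade a * grade b := by
  ext <;> simp [grade]; ring

theorem koszul_koszul (p : ZMod 2) (a : D) : koszul p (koszul p a) = a := by
  unfold koszul; split_ifs <;> simp [grade_grade]

theorem koszul_add (p : ZMod 2) (a b : D) : koszul p (a + b) = koszul p a + koszul p b := by
  unfold koszul; split_ifs <;> simp [grade_add]

theorem koszul_mul (p : ZMod 2) (a b : D) : koszul p (a * b) = koszul p a * koszul p b := by
  unfold koszul; split_ifs <;> simp [grade_mul]

theorem koszul_smul (p : ZMod 2) (r : ℂ) (a : D) : koszul p (r • a) = r • koszul p a := by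
  unfold koszul; split_ifs <;> ext <;> simp [grade]

theorem koszul_zero_left (a : D) : koszul 0 a = a := if_pos rfl

theorem koszul_one_left (a : D) : koszul 1 a = grade a := if_neg one_ne_zero

theorem subst_koszul (p : ZMod 2) (w : ℂ) (a : D) : subst w (koszul p a) = koszul p (subst w a) := by
  unfold koszul; split_ifs
  · rfl
  · ext <;> simp [grade, subst, coordChange]

theorem subst_smul (w r : ℂ) (a : D) : subst w (r • a) = r • subst w a := by
  ext <;> simp [subst, mul_assoc]

theorem IsHolo.smul_koszul {U : Op} {f : ChartPt U → D} (hf : IsHolo f) (p : ZMod 2) (r : ℂ) :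
    IsHolo fun x => r • koszul p (f x) := by
  intro c
  obtain ⟨F, G, hF, hG, h⟩ := hf c
  refine ⟨fun z => r * F z, fun z => r * (if p = 0 then G z else -G z), hF.const_mul r, ?_,
    fun z hz => ?_⟩
  · split_ifs
    exacts [hG.const_mul r, hG.neg.const_mul r]
  · simp only [h z hz]
    unfold koszul
    split_ifs <;> ext <;> simp [grade]

theorem IsParity.smul_koszul {q : ZMod 2} {a : D} (h : IsParity q a) (p : ZMod 2) (r : ℂ) :
    IsParity q (r • koszul p a) := by
  unfold koszul
  refine ⟨fun hq => ?_, fun hq => ?_⟩ <;> split_ifs <;> simp [grade, h.1, h.2, hq]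

/-! ## Morphisms given by constant rescaling of frames -/

/-- The assignment of coefficients `s ↦ (j ↦ c_j (-1)^{p |s|} s_{τ j})` is compatible with the
transition matrices `g` and `h`. -/
def MatrixCompat (p : ZMod 2) {ι κ : Type} [Fintype ι] [Fintype κ] (g : ℂ → Matrix ι ι D)
    (h : ℂ → Matrix κ κ D) (τ : κ → ι) (c : κ → ℂ) : Prop :=
  ∀ w : ℂ, w ≠ 0 → ∀ (v : ι → D) (j : κ),
    c j • koszul p (∑ i, v i * g w i (τ j)) = ∑ l, c l • koszul p (v (τ l)) * h w l j

/-- Lets the compatibility be checked on closed-form matrices with concrete index types, since the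
transition matrices are only known, and only matter, on the overlap. -/
theorem MatrixCompat.congr {p : ZMod 2} {ι κ : Type} [Fintype ι] [Fintype κ]
    {g g' : ℂ → Matrix ι ι D} {h h' : ℂ → Matrix κ κ D} {τ : κ → ι} {c : κ → ℂ}
    (H : MatrixCompat p g h τ c) (hg : ∀ w : ℂ, w ≠ 0 → g' w = g w)
    (hh : ∀ w : ℂ, w ≠ 0 → h' w = h w) : MatrixCompat p g' h' τ c := by
  intro w hw
  rw [hg w hw, hh w hw]
  exact H w hw

/-- The assignment of coefficients `s ↦ (j ↦ c_j (-1)^{p |s|} s_{τ j})` is compatible with the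
gluing of `E` and `F`. -/
def FrameCompat (p : ZMod 2) (E F : LFSheaf) (τ : F.ι → E.ι) (c : F.ι → ℂ) : Prop :=
  MatrixCompat p E.trans F.trans τ c

namespace FrameCompat

variable {p : ZMod 2} {E F : LFSheaf} {τ : F.ι → E.ι} {c : F.ι → ℂ}

/-- The map on sections given by a rescaling of frames. -/
def map (h : FrameCompat p E F τ c) (U : Op) (s : E.sections U) : F.sections U :=
  ⟨fun x j => c j • koszul p (s.1 x (τ j)), fun j => (s.2.1 (τ j)).smul_koszul p (c j),
    fun w hw h₁ h₀ j => by
      -- The coordinate change preserves parity and is `ℂ`-linear, so it commutes with the Koszul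
      -- sign and the constants.
      simp only [s.2.2 w hw h₁ h₀, subst_smul, subst_koszul]
      exact h w hw _ j⟩

theorem map_apply (h : FrameCompat p E F τ c) (U : Op) (s : E.sections U) (x : ChartPt U)
    (j : F.ι) : (h.map U s).1 x j = c j • koszul p (s.1 x (τ j)) := rfl

theorem map_add (h : FrameCompat p E F τ c) (U : Op) (s t : E.sections U) :
    h.map U (s + t) = h.map U s + h.map U t := by
  refine Subtype.ext (funext fun x => funext fun j => ?_)
  change c j • koszul p (s.1 x (τ j) + t.1 x (τ j)) = _
  rw [koszul_add, smul_add]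
  rfl

theorem map_smul_apply (h : FrameCompat p E F τ c) (U : Op) (f : O U) (s : E.sections U)
    (x : ChartPt U) (j : F.ι) :
    (h.map U (f • s)).1 x j = koszul p (f.1 x) * (h.map U s).1 x j := by
  change c j • koszul p (f.1 x * s.1 x (τ j)) = koszul p (f.1 x) * (c j • koszul p (s.1 x (τ j)))
  rw [koszul_mul, mul_smul_comm]

/-- Parities need to match only where the constant is nonzero: `Θ` in degree `n = 0` has a zero
component whose source index is arbitrary. -/
theorem map_isHomog (h : FrameCompat p E F τ c) (hp : ∀ j, c j ≠ 0 → E.parity (τ j) = p + F.parity j)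
    {U : Op} {q : ZMod 2} {s : E.sections U} (hs : E.IsHomog q s) :
    F.IsHomog (q + p) (h.map U s) := by
  intro x j
  rw [map_apply]
  by_cases hc : c j = 0
  · rw [hc, zero_smul]
    exact ⟨fun _ => rfl, fun _ => rfl⟩
  · have := hs x (τ j)
    rw [hp j hc, ← add_assoc] at this
    exact this.smul_koszul p (c j)

/-- An invertible rescaling of frames has an inverse of the same kind. -/
theorem symm {τ : F.ι ≃ E.ι} (h : FrameCompat p E F τ c) (hc : ∀ j, c j ≠ 0) :
    FrameCompat p F E τ.symm fun i => (c (τ.symm i))⁻¹ := by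
  intro w hw v j
  -- Compatibility of the forward map is applied to the vector that the inverse rescaling produces
  -- from `v`.
  have := h w hw (fun i => (c (τ.symm i))⁻¹ • koszul p (v (τ.symm i))) (τ.symm j)
  simp only [Equiv.symm_apply_apply, Equiv.apply_symm_apply, koszul_smul, koszul_koszul,
    smul_inv_smul₀ (hc _)] at this
  rw [← this, koszul_smul, koszul_koszul, inv_smul_smul₀ (hc _)]

theorem map_symm_map {τ : F.ι ≃ E.ι} (h : FrameCompat p E F τ c) (hc : ∀ j, c j ≠ 0) (U : Op)
    (s : E.sections U) : (h.symm hc).map U (h.map U s) = s := by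
  refine Subtype.ext (funext fun x => funext fun j => ?_)
  rw [map_apply, map_apply, koszul_smul, koszul_koszul, inv_smul_smul₀ (hc _),
    Equiv.apply_symm_apply]

theorem map_map_symm {τ : F.ι ≃ E.ι} (h : FrameCompat p E F τ c) (hc : ∀ j, c j ≠ 0) (U : Op)
    (s : F.sections U) : h.map U ((h.symm hc).map U s) = s := by
  refine Subtype.ext (funext fun x => funext fun j => ?_)
  rw [map_apply, map_apply, koszul_smul, koszul_koszul, Equiv.symm_apply_apply,
    smul_inv_smul₀ (hc _)]

theorem map_bijective {τ : F.ι ≃ E.ι} (h : FrameCompat p E F τ c) (hc : ∀ j, c j ≠ 0) (U : Op) :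
    Function.Bijective (h.map U) :=
  Function.bijective_iff_has_inverse.2 ⟨_, h.map_symm_map hc U, h.map_map_symm hc U⟩

/-- The isomorphism of sheaves given by an invertible even rescaling of frames. -/
def toSheafIso {τ : F.ι ≃ E.ι} (h : FrameCompat 0 E F τ c) (hc : ∀ j, c j ≠ 0)
    (hp : ∀ j, E.parity (τ j) = F.parity j) : SheafIso E F where
  app U :=
    { toFun := h.map U
      map_add' := h.map_add U
      map_smul' := fun f s => Subtype.ext (funext fun x => funext fun j => by
        rw [map_smul_apply, koszul_zero_left]; rfl)
      invFun := (h.symm hc).map U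
      left_inv := h.map_symm_map hc U
      right_inv := h.map_map_symm hc U }
  app_res _ _ := rfl
  app_homog U q s hs := by
    simpa using h.map_isHomog (fun j _ => by rw [hp, zero_add]) hs

theorem toSheafIso_apply {τ : F.ι ≃ E.ι} (h : FrameCompat 0 E F τ c) (hc : ∀ j, c j ≠ 0)
    (hp : ∀ j, E.parity (τ j) = F.parity j) (U : Op) (s : E.sections U) (x : ChartPt U) (j : F.ι) :
    ((h.toSheafIso hc hp).app U s).1 x j = c j • s.1 x (τ j) := by
  change c j • koszul 0 _ = _
  rw [koszul_zero_left]

/-- The odd morphism of sheaves given by an odd rescaling of frames. -/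
def toOddHom (h : FrameCompat 1 E F τ c) (hp : ∀ j, c j ≠ 0 → E.parity (τ j) = 1 + F.parity j) :
    OddHom E F where
  app U := AddMonoidHom.mk' (h.map U) (h.map_add U)
  app_res _ _ := rfl
  app_homog U q s hs := h.map_isHomog hp hs
  app_smul U f s x i := by
    rw [← koszul_one_left]
    exact h.map_smul_apply U f s x i

theorem toOddHom_apply (h : FrameCompat 1 E F τ c)
    (hp : ∀ j, c j ≠ 0 → E.parity (τ j) = 1 + F.parity j) (U : Op) (s : E.sections U)
    (x : ChartPt U) (j : F.ι) :
    ((h.toOddHom hp).app U s).1 x j = c j • grade (s.1 x (τ j)) := by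
  change c j • koszul 1 _ = _
  rw [koszul_one_left]

end FrameCompat

/-! ### Transition matrices of the forms -/

/-- The index set of the frame of `Sym^n`. -/
abbrev SymIdx (n : ℕ) : Type := {b : Fin 2 // (b : ℕ) ≤ n}

/-- The transition matrix of `Ω^{-k;0}`. -/
def inverseTrans (k : ℕ) (w : ℂ) : Matrix (Fin 2) (Fin 2) D :=
  !![TrivSqZeroExt.inl (w ^ k), TrivSqZeroExt.inr (k * w ^ (k - 1 : ℤ));
    0, TrivSqZeroExt.inl (-w ^ (k - 1 : ℤ))]

/-- The transition matrix of `Sym^n Π𝒯`. -/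
def symTrans (n : ℕ) (w : ℂ) : Matrix (SymIdx n) (SymIdx n) D := fun i j =>
  !![TrivSqZeroExt.inl (w ^ n), 0;
    TrivSqZeroExt.inr (-w ^ n), TrivSqZeroExt.inl (-w ^ (n + 1))] i.1 j.1

/-- The transition matrix of `Ber ⊗ Sym^n Π𝒯`. -/
def integralTrans (n : ℕ) (w : ℂ) : Matrix (Unit × SymIdx n) (Unit × SymIdx n) D := fun i j =>
  !![TrivSqZeroExt.inl (-w ^ (n - 1 : ℤ)), 0;
    TrivSqZeroExt.inr (w ^ (n - 1 : ℤ)), TrivSqZeroExt.inl (w ^ n)] i.2.1 j.2.1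

/-- The transition matrix of `Π Ber ⊗ Sym^n Π𝒯`. -/
def piBerTrans (n : ℕ) (w : ℂ) : Matrix (Unit × SymIdx n) (Unit × SymIdx n) D := fun i j =>
  !![TrivSqZeroExt.inl (-w ^ (n - 1 : ℤ)), 0;
    TrivSqZeroExt.inr (-w ^ (n - 1 : ℤ)), TrivSqZeroExt.inl (w ^ n)] i.2.1 j.2.1

theorem inverseForms_trans (k : ℕ) {w : ℂ} (hw : w ≠ 0) :
    (inverseForms k).trans w = inverseTrans k w := by
  have h := hasBlocks_cotangent w
  have h' := inv_ne_zero hw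
  refine Matrix.ext (m := Fin 2) (n := Fin 2) fun i j => ?_
  change monomialCoeff (-(k : ℤ)) (cotangent.shift.monomial .θ .z (-(k : ℤ)) w i) j = _
  fin_cases i <;> fin_cases j
  · refine (h.coeff_zero_zero h' _).trans ?_
    simp [inverseTrans]
  · refine (h.coeff_zero_one h' _).trans ?_
    -- Turns `(w⁻¹)^(-k-1)` into `w^(k+1)`.
    rw [← neg_add', inv_zpow', neg_neg, zpow_add₀ hw]
    simp only [inverseTrans, zpow_sub₀ hw]
    ext <;> simp
    field_simp
  · refine (h.coeff_one_zero h' _).trans ?_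
    simp [inverseTrans]
  · refine (h.coeff_one_one h' _).trans ?_
    rw [← neg_add', inv_zpow', neg_neg, zpow_add₀ hw]
    simp only [inverseTrans, zpow_sub₀ hw]
    ext <;> simp
    field_simp

theorem symPiT_trans (n : ℕ) {w : ℂ} (hw : w ≠ 0) : (symPiT n).trans w = symTrans n w := by
  have h := hasBlocks_tangent hw
  refine Matrix.ext (m := SymIdx n) (n := SymIdx n) fun i j => ?_
  change monomialCoeff n (tangent.shift.monomial .θ .z n w i.1) j.1 = _
  rw [symTrans]
  -- Forgetting the bound `b ≤ n` is harmless: the formulas hold for all four entries even when `n =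
  -- 0`.
  generalize i.1 = i
  generalize j.1 = j
  fin_cases i <;> fin_cases j
  · refine (h.coeff_zero_zero hw _).trans ?_
    simp
  · refine (h.coeff_zero_one hw _).trans ?_
    simp
  · refine (h.coeff_one_zero hw _).trans ?_
    rw [zpow_sub₀ hw]
    ext <;> simp
    field_simp
  · refine (h.coeff_one_one hw _).trans ?_
    rw [zpow_sub₀ hw]
    ext <;> simp
    field_simp
    ring

theorem integralForms_trans (n : ℕ) {w : ℂ} (hw : w ≠ 0) :
    (integralForms n).trans w = integralTrans n w := by
  refine Matrix.ext (m := Unit × SymIdx n) (n := Unit × SymIdx n) fun i j => ?_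
  change berP.trans w i.1 j.1 * koszul 0 ((symPiT n).trans w i.2 j.2) = _
  rw [berP_trans hw, koszul_zero_left, symPiT_trans n hw, symTrans, integralTrans]
  generalize i.2.1 = i
  generalize j.2.1 = j
  fin_cases i <;> fin_cases j <;> ext <;> simp [zpow_sub₀ hw, pow_succ'] <;> field_simp

/-- Since `π𝒟` is odd, the Koszul sign of the tensor product negates the `η` entry and nothing else.
-/
theorem piBerSym_trans (n : ℕ) {w : ℂ} (hw : w ≠ 0) :
    (piBerSym n).trans w = piBerTrans n w := by
  refine Matrix.ext (m := Unit × SymIdx n) (n := Unit × SymIdx n) fun i j => ?_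
  change berP.trans w i.1 j.1 * koszul 1 ((symPiT n).trans w i.2 j.2) = _
  rw [berP_trans hw, koszul_one_left, symPiT_trans n hw, symTrans, piBerTrans]
  generalize i.2.1 = i
  generalize j.2.1 = j
  fin_cases i <;> fin_cases j <;> ext <;> simp [zpow_sub₀ hw, grade, pow_succ'] <;>
    field_simp

theorem structureSheaf_sum_shift_berP_trans {w : ℂ} (hw : w ≠ 0) :
    (structureSheaf.sum berP.shift).trans w =
      (Matrix.fromBlocks 1 0 0 fun _ _ => TrivSqZeroExt.inl (-w⁻¹) :
        Matrix (Unit ⊕ Unit) (Unit ⊕ Unit) D) := by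
  have h : (berP.shift.trans w : Matrix Unit Unit D) = fun _ _ => TrivSqZeroExt.inl (-w⁻¹) :=
    funext fun i => funext fun j => berP_trans hw i j
  exact congrArg (Matrix.fromBlocks (1 : Matrix Unit Unit D) 0 0) h

/-! ### The frames -/

/-- The bijection between the frames of `L ⊗ Sym^n Π𝒯` and `Ω^{-n;0}`, for `n > 0`. -/
def frameEquiv (n : ℕ) (hn : 0 < n) : Unit × SymIdx n ≃ Fin 2 where
  -- The order is reversed to match parities: `π𝒟 ⊗ (π∂_θ)^n` is odd, like `dz/dθ^(n+1)`.
  toFun x := Fin.rev x.2.1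
  invFun b := ((), ⟨Fin.rev b, by omega⟩)
  left_inv x := by simp
  right_inv b := by simp

theorem frameEquiv_idxZ (n : ℕ) (hn : 0 < n) : frameEquiv n hn (idxZ n hn) = 0 := rfl

theorem frameEquiv_idxTheta (n : ℕ) (hn : 0 < n) : frameEquiv n hn (idxTheta n) = 1 := rfl

theorem frameEquiv_symm_zero (n : ℕ) (hn : 0 < n) : (frameEquiv n hn).symm 0 = idxZ n hn := rfl

theorem frameEquiv_symm_one (n : ℕ) (hn : 0 < n) : (frameEquiv n hn).symm 1 = idxTheta n := rfl

theorem forall_idx {n : ℕ} (hn : 0 < n) {Q : Unit × SymIdx n → Prop} :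
    (∀ i, Q i) ↔ Q (idxZ n hn) ∧ Q (idxTheta n) := by
  rw [← (frameEquiv n hn).symm.forall_congr_right, Fin.forall_fin_two]
  rfl

theorem sum_idx {n : ℕ} (hn : 0 < n) {M : Type*} [AddCommMonoid M] (f : Unit × SymIdx n → M) :
    ∑ i, f i = f (idxZ n hn) + f (idxTheta n) := by
  rw [← (frameEquiv n hn).symm.sum_comp, Fin.sum_univ_two]
  rfl

theorem eq_idxTheta_zero (i : Unit × SymIdx 0) : i = idxTheta 0 :=
  Prod.ext rfl (Subtype.ext (Fin.ext (Nat.le_zero.1 i.2.2)))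

theorem sum_idx_zero {M : Type*} [AddCommMonoid M] (f : Unit × SymIdx 0 → M) :
    ∑ i, f i = f (idxTheta 0) :=
  Fintype.sum_eq_single _ fun x hx => (hx (eq_idxTheta_zero x)).elim

/-- The bijection between the frames of `𝒪 ⊕ Π Ber` and `Ω^{0;0}`. -/
def sumEquiv : Unit ⊕ Unit ≃ Fin 2 where
  toFun := Sum.elim (fun _ => 0) fun _ => 1
  invFun := ![Sum.inl (), Sum.inr ()]
  left_inv := Sum.forall.2 ⟨fun _ => rfl, fun _ => rfl⟩
  right_inv := Fin.forall_fin_two.2 ⟨rfl, rfl⟩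

theorem sumEquiv_inl (u : Unit) : sumEquiv (Sum.inl u) = 0 := rfl

theorem sumEquiv_inr (u : Unit) : sumEquiv (Sum.inr u) = 1 := rfl

/-! ### Compatibility of the rescalings with the transition matrices -/

/-- The diagonal entries agree, so the only constraint comes from the odd entries `k w^(k-1) η` and
`-w^(k-1) η`; it is the ratio in `hc`. -/
theorem matrixCompat_inverse_piBer {k : ℕ} (hk : 0 < k) {c : Unit × SymIdx k → ℂ}
    (hc : c (idxZ k hk) = -k * c (idxTheta k)) :
    MatrixCompat 0 (inverseTrans k) (piBerTrans k) (frameEquiv k hk) c := by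
  intro w hw v
  simp only [Fin.sum_univ_two, sum_idx hk, koszul_zero_left, forall_idx hk, frameEquiv_idxZ,
    frameEquiv_idxTheta, hc]
  constructor <;> ext <;> simp [inverseTrans, piBerTrans, idxZ, idxTheta]; ring

/-- The grading involution is multiplicative and carries one transition matrix entrywise to the
other. -/
theorem matrixCompat_integral_piBer (n : ℕ) :
    MatrixCompat 1 (integralTrans n) (piBerTrans n) id 1 := by
  have h (w : ℂ) (i j) : grade (integralTrans n w i j) = piBerTrans n w i j := by
    rw [integralTrans, piBerTrans]
    generalize i.2.1 = i
    generalize j.2.1 = j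
    fin_cases i <;> fin_cases j <;> ext <;> simp [grade]
  intro w _ v j
  have hs (s : Finset (Unit × SymIdx n)) (f : Unit × SymIdx n → D) :
      grade (∑ i ∈ s, f i) = ∑ i ∈ s, grade (f i) :=
    map_sum (AddMonoidHom.mk' grade grade_add) f s
  simp [koszul_one_left, hs, grade_mul, h]

/-- The grading involution first makes the odd entry `-w^(n-1) η`; comparison with `n w^(n-1) η`
then forces the ratio in `hc`. -/
theorem matrixCompat_integral_inverse {n : ℕ} (hn : 0 < n) {c : Fin 2 → ℂ}
    (hc : c 1 = -n * c 0) :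
    MatrixCompat 1 (integralTrans n) (inverseTrans n) (frameEquiv n hn).symm c := by
  intro w hw v
  simp only [Fin.sum_univ_two, sum_idx hn, koszul_one_left, Fin.forall_fin_two,
    frameEquiv_symm_zero, frameEquiv_symm_one, hc]
  constructor <;> ext <;> simp [inverseTrans, integralTrans, idxZ, idxTheta, grade]; ring

/-- The row of `dz/dθ` is `(0, -1/w)`, so `dz/dθ` spans a subsheaf on its own, with the transition
function of `Ber`. -/
theorem matrixCompat_integral_inverse_zero {c : Fin 2 → ℂ} (hc : c 0 = 0) :
    MatrixCompat 1 (integralTrans 0) (inverseTrans 0) (fun _ => idxTheta 0) c := by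
  intro w hw v
  simp only [Fin.sum_univ_two, sum_idx_zero, koszul_one_left, Fin.forall_fin_two, hc]
  constructor <;> ext <;> simp [inverseTrans, integralTrans, idxTheta, grade]

theorem matrixCompat_inverse_sum :
    MatrixCompat 0 (inverseTrans 0)
      (fun w => Matrix.fromBlocks 1 0 0 fun _ _ => TrivSqZeroExt.inl (-w⁻¹)) sumEquiv 1 := by
  intro w hw v
  simp only [Fin.sum_univ_two, Fintype.sum_sum_type, koszul_zero_left, Sum.forall, sumEquiv_inl,
    sumEquiv_inr]
  constructor <;> intro _ <;> ext <;> simp [inverseTrans, Matrix.fromBlocks]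

/-! ### The morphisms -/

theorem sqrt_natCast_ne_zero {k : ℕ} (hk : 0 < k) : ((√(k : ℝ) : ℝ) : ℂ) ≠ 0 :=
  Complex.ofReal_ne_zero.2 (Real.sqrt_ne_zero'.2 (Nat.cast_pos.2 hk))

theorem natCast_mul_inv_sqrt (k : ℕ) :
    (k : ℂ) * ((1 / √(k : ℝ) : ℝ) : ℂ) = ((√(k : ℝ) : ℝ) : ℂ) := by
  rw [← Complex.ofReal_natCast, ← Complex.ofReal_mul, mul_one_div, Real.div_sqrt]

theorem thetaConst_ne_zero (n : ℕ) : thetaConst n ≠ 0 :=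
  mul_ne_zero (pow_ne_zero _ (neg_ne_zero.2 one_ne_zero)) (Nat.cast_ne_zero.2 n.factorial_ne_zero)

/-- The recursion for `(-1)^n n!` is precisely the ratio required for `Θ` to glue. -/
theorem thetaConst_eq {n : ℕ} (hn : 0 < n) : thetaConst n = -n * thetaConst (n - 1) := by
  obtain ⟨m, rfl⟩ := Nat.exists_eq_succ_of_ne_zero hn.ne'
  simp only [thetaConst, Nat.succ_eq_add_one, Nat.add_sub_cancel, Nat.factorial_succ, pow_succ]
  push_cast
  ring

theorem exists_inverseForms_iso_piBerSym (k : ℕ) (hk : 0 < k) :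
    ∃ φ : SheafIso (inverseForms k) (piBerSym k),
      ∀ (U : Op) (s : (inverseForms k).sections U) (x : ChartPt U),
        (φ.app U s).1 x (idxZ k hk) = ((√(k : ℝ) : ℝ) : ℂ) • s.1 x (0 : Fin 2) ∧
        (φ.app U s).1 x (idxTheta k) = (-(1 / √(k : ℝ) : ℝ) : ℂ) • s.1 x (1 : Fin 2) := by
  let c : Unit × SymIdx k → ℂ := fun i =>
    if i.2.1 = 0 then (-(1 / √(k : ℝ) : ℝ) : ℂ) else ((√(k : ℝ) : ℝ) : ℂ)
  have hZ : c (idxZ k hk) = ((√(k : ℝ) : ℝ) : ℂ) := rfl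
  have hT : c (idxTheta k) = (-(1 / √(k : ℝ) : ℝ) : ℂ) := rfl
  have h0 := sqrt_natCast_ne_zero hk
  have H : FrameCompat 0 (inverseForms k) (piBerSym k) (frameEquiv k hk) c :=
    (matrixCompat_inverse_piBer hk (by rw [hZ, hT, neg_mul_neg, natCast_mul_inv_sqrt])).congr
      (fun w hw => inverseForms_trans k hw) fun w hw => piBerSym_trans k hw
  have hc : ∀ i, c i ≠ 0 := by
    refine (forall_idx hk).2 ⟨h0, neg_ne_zero.2 ?_⟩
    rw [one_div, Complex.ofReal_inv]
    exact inv_ne_zero h0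
  have hp : ∀ i : Unit × SymIdx k, (inverseForms k).parity (frameEquiv k hk i) =
      (piBerSym k).parity i := (forall_idx hk).2
    ⟨(by decide : ((0 : ℕ) : ZMod 2) = 0 + 1 + ((1 : ℕ) : ZMod 2)),
      (by decide : ((1 : ℕ) : ZMod 2) = 0 + 1 + ((0 : ℕ) : ZMod 2))⟩
  exact ⟨H.toSheafIso hc hp, fun U s x => ⟨H.toSheafIso_apply hc hp U s x (idxZ k hk),
    H.toSheafIso_apply hc hp U s x (idxTheta k)⟩⟩

theorem exists_inverseForms_zero_iso :
    ∃ ψ : SheafIso (inverseForms 0) (structureSheaf.sum berP.shift),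
      ∀ (U : Op) (s : (inverseForms 0).sections U) (x : ChartPt U),
        (ψ.app U s).1 x (Sum.inl ()) = s.1 x (0 : Fin 2) ∧
        (ψ.app U s).1 x (Sum.inr ()) = s.1 x (1 : Fin 2) := by
  have H : FrameCompat 0 (inverseForms 0) (structureSheaf.sum berP.shift) sumEquiv 1 :=
    matrixCompat_inverse_sum.congr (fun w hw => inverseForms_trans 0 hw)
      fun w hw => structureSheaf_sum_shift_berP_trans hw
  have hp : ∀ i : Unit ⊕ Unit, (inverseForms 0).parity (sumEquiv i) =
      (structureSheaf.sum berP.shift).parity i := Sum.forall.2 ⟨fun _ => rfl, fun _ => rfl⟩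
  have hc : ∀ i : Unit ⊕ Unit, (1 : Unit ⊕ Unit → ℂ) i ≠ 0 := fun _ => one_ne_zero
  exact ⟨H.toSheafIso hc hp, fun U s x =>
    ⟨(H.toSheafIso_apply hc hp U s x (Sum.inl ())).trans (one_smul ℂ _),
      (H.toSheafIso_apply hc hp U s x (Sum.inr ())).trans (one_smul ℂ _)⟩⟩

theorem exists_parityChange (n : ℕ) : ∃ P : OddHom (integralForms n) (piBerSym n),
    IsParityChange n P ∧ ∀ U, Function.Bijective (P.app U) := by
  have H : FrameCompat 1 (integralForms n) (piBerSym n) (Equiv.refl (Unit × SymIdx n)) 1 :=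
    (matrixCompat_integral_piBer n).congr (fun w hw => integralForms_trans n hw)
      fun w hw => piBerSym_trans n hw
  have hp (b : ZMod 2) : 0 + b = 1 + (0 + 1 + b) := by revert b; decide
  exact ⟨H.toOddHom fun i _ => hp ((i.2.1 : ℕ) : ZMod 2), fun U s x i =>
    (H.toOddHom_apply _ U s x i).trans (one_smul ℂ _), H.map_bijective fun _ => one_ne_zero⟩

theorem exists_heaviside_of_pos {n : ℕ} (hn : 0 < n) :
    ∃ Θ : OddHom (integralForms n) (inverseForms n),
      IsHeaviside n Θ ∧ ∀ U, Function.Bijective (Θ.app U) := by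
  have H : FrameCompat 1 (integralForms n) (inverseForms n) (frameEquiv n hn).symm
      ![thetaConst (n - 1), thetaConst n] :=
    (matrixCompat_integral_inverse hn (thetaConst_eq hn)).congr
      (fun w hw => integralForms_trans n hw) fun w hw => inverseForms_trans n hw
  have hp : ∀ i : Fin 2, (integralForms n).parity ((frameEquiv n hn).symm i) =
      1 + (inverseForms n).parity i := Fin.forall_fin_two.2
    ⟨(by decide : 0 + ((1 : ℕ) : ZMod 2) = 1 + ((0 : ℕ) : ZMod 2)),
      (by decide : 0 + ((0 : ℕ) : ZMod 2) = 1 + ((1 : ℕ) : ZMod 2))⟩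
  have hc : ∀ i : Fin 2, ![thetaConst (n - 1), thetaConst n] i ≠ 0 :=
    Fin.forall_fin_two.2 ⟨thetaConst_ne_zero _, thetaConst_ne_zero _⟩
  refine ⟨H.toOddHom fun i _ => hp i, fun U s x => ⟨H.toOddHom_apply _ U s x (1 : Fin 2), ?_⟩,
    H.map_bijective hc⟩
  rw [dif_pos hn]
  exact H.toOddHom_apply _ U s x (0 : Fin 2)

theorem exists_heaviside_zero :
    ∃ Θ : OddHom (integralForms 0) (inverseForms 0), IsHeaviside 0 Θ := by
  -- `Sym^0` has a single frame element, so the source of index `0` is a default value, cancelled by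
  -- the constant `0`.
  have H : FrameCompat 1 (integralForms 0) (inverseForms 0) (fun _ => idxTheta 0)
      ![0, thetaConst 0] :=
    (matrixCompat_integral_inverse_zero rfl).congr
      (fun w hw => integralForms_trans 0 hw) fun w hw => inverseForms_trans 0 hw
  have hp : ∀ i : Fin 2, ![0, thetaConst 0] i ≠ 0 → (integralForms 0).parity (idxTheta 0) =
      1 + (inverseForms 0).parity i := Fin.forall_fin_two.2 ⟨fun h => (h rfl).elim, fun _ => rfl⟩
  refine ⟨H.toOddHom hp, fun U s x => ⟨H.toOddHom_apply _ U s x (1 : Fin 2), ?_⟩⟩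
  rw [dif_neg (lt_irrefl 0)]
  exact (H.toOddHom_apply _ U s x (0 : Fin 2)).trans (zero_smul ℂ _)

theorem exists_heaviside (n : ℕ) : ∃ Θ : OddHom (integralForms n) (inverseForms n),
    IsHeaviside n Θ ∧ (0 < n → ∀ U, Function.Bijective (Θ.app U)) := by
  rcases n.eq_zero_or_pos with rfl | hn
  · obtain ⟨Θ, hΘ⟩ := exists_heaviside_zero
    exact ⟨Θ, hΘ, fun h => (lt_irrefl 0 h).elim⟩
  · obtain ⟨Θ, hΘ, h⟩ := exists_heaviside_of_pos hn
    exact ⟨Θ, hΘ, fun _ => h⟩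

theorem IsHeaviside.apply_one_zero {Θ : OddHom (integralForms 0) (inverseForms 0)}
    (hΘ : IsHeaviside 0 Θ) (U : Op) (s : (integralForms 0).sections U) (x : ChartPt U) :
    (Θ.app U s).1 x (1 : Fin 2) = grade (s.1 x (idxTheta 0)) := by
  rw [(hΘ U s x).1]
  simp [thetaConst]

theorem IsHeaviside.injective_zero {Θ : OddHom (integralForms 0) (inverseForms 0)}
    (hΘ : IsHeaviside 0 Θ) (U : Op) : Function.Injective (Θ.app U) := by
  intro s t h
  refine Subtype.ext (funext fun x => funext fun i => ?_)
  have hx := hΘ.apply_one_zero U s x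
  rw [h, hΘ.apply_one_zero U t x] at hx
  have hi : i = idxTheta 0 := eq_idxTheta_zero i
  rw [hi]
  exact grade_injective hx.symm

end P11

end

theorem mainTheorem2 :
    ∃ (φ : ∀ k : ℕ, 0 < k → SheafIso (inverseForms k) (piBerSym k))
      (ψ : SheafIso (inverseForms 0) (structureSheaf.sum berP.shift))
      (P : ∀ n : ℕ, OddHom (integralForms n) (piBerSym n))
      (Θ : ∀ n : ℕ, OddHom (integralForms n) (inverseForms n)),
      -- the isomorphisms in negative degrees are constant rescalings of the frames
      (∀ (k : ℕ) (hk : 0 < k) (U : Op) (s : (inverseForms k).sections U) (x : ChartPt U),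
        ((φ k hk).app U s).1 x (idxZ k hk) = ((√(k : ℝ) : ℝ) : ℂ) • s.1 x (0 : Fin 2) ∧
        ((φ k hk).app U s).1 x (idxTheta k) = (-(1 / √(k : ℝ) : ℝ) : ℂ) • s.1 x (1 : Fin 2)) ∧
      -- degree zero: `1 ↦ 1` and `dz/dθ ↦ π𝒟`
      (∀ (U : Op) (s : (inverseForms 0).sections U) (x : ChartPt U),
        (ψ.app U s).1 x (Sum.inl ()) = s.1 x (0 : Fin 2) ∧
        (ψ.app U s).1 x (Sum.inr ()) = s.1 x (1 : Fin 2)) ∧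
      (∀ n : ℕ, IsParityChange n (P n)) ∧
      (∀ n : ℕ, IsHeaviside n (Θ n)) ∧
      -- below the critical degree, `Θ` is an isomorphism up to parity, namely `π` up to a constant
      (∀ (n : ℕ) (hn : 0 < n) (U : Op),
        Function.Bijective ((P n).app U) ∧ Function.Bijective ((Θ n).app U) ∧
        ∀ (s : (integralForms n).sections U) (x : ChartPt U)
          (i : Unit × {b : Fin 2 // (b : ℕ) ≤ n}),
          ((φ n hn).app U ((Θ n).app U s)).1 x i =
            (thetaConst (n - 1) * ((√(n : ℝ) : ℝ) : ℂ)) • ((P n).app U s).1 x i) ∧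
      -- critical degree: `Θ` is the injection `s ↦ (0, π s)` of `Ber` into `𝒪 ⊕ Π Ber`
      (∀ U : Op, Function.Injective ((Θ 0).app U) ∧
        ∀ (s : (integralForms 0).sections U) (x : ChartPt U),
          (ψ.app U ((Θ 0).app U s)).1 x (Sum.inl ()) = 0 ∧
          (ψ.app U ((Θ 0).app U s)).1 x (Sum.inr ()) = ((P 0).app U s).1 x (idxTheta 0)) := by
  choose φ hφ using exists_inverseForms_iso_piBerSym
  obtain ⟨ψ, hψ⟩ := exists_inverseForms_zero_iso
  choose P hP hPb using exists_parityChange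
  choose Θ hΘ hΘb using exists_heaviside
  refine ⟨φ, ψ, P, Θ, hφ, hψ, hP, hΘ, fun n hn U => ⟨hPb n U, hΘb n hn U, fun s x => ?_⟩,
    fun U => ⟨(hΘ 0).injective_zero U, fun s x => ⟨?_, ?_⟩⟩⟩
  · refine (forall_idx hn).2 ⟨?_, ?_⟩
    · rw [(hφ n hn U _ x).1, (hΘ n U s x).2, dif_pos hn, hP n U s x (idxZ n hn), smul_smul,
        mul_comm]
    -- Here the constant is `(-1/√n) · (-n) · thetaConst (n - 1)`, and `n/√n = √n` gives the same
    -- multiple of `π` as on the other frame element.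
    · rw [(hφ n hn U _ x).2, (hΘ n U s x).1, hP n U s x (idxTheta n), smul_smul, thetaConst_eq hn,
        ← natCast_mul_inv_sqrt n]
      congr 1
      ring
  · rw [(hψ U _ x).1, (hΘ 0 U s x).2, dif_neg (lt_irrefl 0)]
  · rw [(hψ U _ x).2, (hΘ 0).apply_one_zero U s x, hP 0 U s x (idxTheta 0)]
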